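/- Let $\beta\omega$ be the Stone–Čech compactification of the discrete space $\omega=\{0,1,2,\dots\}$, realized as the space of ultrafilters on $\omega$, and let $\omega^*=\beta\omega\setminus\omega$ be the subspace of nonprincipal ultrafilters. Let $\sigma:\omega^*\to\omega^*$ be the shift map, which sends an ultrafilter $p$ to the ultrafilter generated by $\{A+1 : A\in p\}$, where $A+1=\{n+1 : n\in A\}$; it is a homeomorphism of $\omega^*$ onto itself, with inverse $\sigma^{-1}$. For a compact Hausdorff space $X$ and a continuous map $f:X\to X$, say that $(X,f)$ is a quotient of $(\omega^*,\sigma)$ if there is a continuous surjection $Q:\omega^*\to X$ with $Q\circ\sigma=f\circ Q$. Assume the Continuum Hypothesis, $2^{\aleph_0}=\aleph_1$. Then $(\omega^*,\sigma^{-1})$ is a quotient of $(\omega^*,\sigma)$; that is, there is a continuous surjection $Q:\omega^*\to\omega^*$ such that $Q\circ\sigma=\sigma^{-1}\circ Q$. -/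

import Mathlib

open Cardinal

/-- The remainder `ω* = βω \ ω`. Here `βω` is the space of ultrafilters on `ℕ` with the Stone
topology, and `n : ℕ` is identified with the principal ultrafilter `pure n`. The topology on `ω*`
is the subspace topology. -/
abbrev OmegaStar : Type :=
  {p : Ultrafilter ℕ // p ∉ Set.range (pure : ℕ → Ultrafilter ℕ)}

/-- `βω` minus its (isolated) principal points is closed, so `ω*` is compact. -/
instance OmegaStar.instCompactSpace : CompactSpace OmegaStar := by
  have ho : IsOpen (Set.range (pure : ℕ → Ultrafilter ℕ)) := by
    have h : Set.range (pure : ℕ → Ultrafilter ℕ) =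
        ⋃ n : ℕ, {p : Ultrafilter ℕ | ({n} : Set ℕ) ∈ p} := by
      ext p
      simp only [Set.mem_range, Set.mem_iUnion, Set.mem_setOf_eq]
      constructor
      · rintro ⟨n, rfl⟩
        exact ⟨n, by simp⟩
      · rintro ⟨n, hn⟩
        obtain ⟨x, hx, hp⟩ := Ultrafilter.eq_pure_of_finite_mem (Set.finite_singleton n) hn
        exact ⟨x, hp.symm⟩
    rw [h]
    exact isOpen_iUnion fun n => ultrafilter_isOpen_basic _
  exact isCompact_iff_compactSpace.mp ho.isClosed_compl.isCompact

/-- The shift map on `βω`: it sends `p` to the ultrafilter generated by `{A + 1 | A ∈ p}`, that is,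
to the image ultrafilter of `p` under `n ↦ n + 1`. -/
def shiftBeta (p : Ultrafilter ℕ) : Ultrafilter ℕ := p.map (fun n => n + 1)

theorem continuous_shiftBeta : Continuous shiftBeta := by
  refine ultrafilterBasis_is_basis.continuous_iff.2 ?_
  rintro _ ⟨s, rfl⟩
  exact ultrafilter_isOpen_basic ((fun n => n + 1) ⁻¹' s)

theorem shiftBeta_injective : Function.Injective shiftBeta := by
  intro p q h
  have hinj : Function.Injective (fun n : ℕ => n + 1) := fun a b hab => by simpa using hab
  apply Ultrafilter.coe_injective
  apply Filter.map_injective hinj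
  have := congrArg (fun u : Ultrafilter ℕ => (u : Filter ℕ)) h
  simpa [shiftBeta] using this

theorem shiftBeta_pure (n : ℕ) : shiftBeta (pure n) = pure (n + 1) := by
  simp [shiftBeta, Ultrafilter.map_pure]

theorem shiftBeta_mem_omegaStar {p : Ultrafilter ℕ}
    (hp : p ∉ Set.range (pure : ℕ → Ultrafilter ℕ)) :
    shiftBeta p ∉ Set.range (pure : ℕ → Ultrafilter ℕ) := by
  rintro ⟨n, hn⟩
  have h1 : ({n} : Set ℕ) ∈ shiftBeta p := by rw [← hn]; simp
  have h2 : (fun m : ℕ => m + 1) ⁻¹' {n} ∈ p := h1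
  have hfin : ((fun m : ℕ => m + 1) ⁻¹' {n}).Finite :=
    (Set.finite_singleton n).preimage (fun a _ b _ hab => by simpa using hab)
  obtain ⟨x, _, hx⟩ := Ultrafilter.eq_pure_of_finite_mem hfin h2
  exact hp ⟨x, hx.symm⟩

theorem exists_shiftBeta_eq {q : Ultrafilter ℕ}
    (hq : q ∉ Set.range (pure : ℕ → Ultrafilter ℕ)) : ∃ p, shiftBeta p = q := by
  have h0 : ({0} : Set ℕ)ᶜ ∈ q := by
    rw [Ultrafilter.compl_mem_iff_notMem]
    intro h
    obtain ⟨x, _, hx⟩ := Ultrafilter.eq_pure_of_finite_mem (Set.finite_singleton 0) h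
    exact hq ⟨x, hx.symm⟩
  refine ⟨q.map (fun n => n - 1), ?_⟩
  apply Ultrafilter.ext
  intro s
  change {n : ℕ | n - 1 + 1 ∈ s} ∈ q ↔ s ∈ q
  constructor
  · intro h
    filter_upwards [h, h0] with n hn hn0
    have : n - 1 + 1 = n := Nat.sub_add_cancel (Nat.one_le_iff_ne_zero.2 hn0)
    rwa [← this]
  · intro h
    filter_upwards [h, h0] with n hn hn0
    have : n - 1 + 1 = n := Nat.sub_add_cancel (Nat.one_le_iff_ne_zero.2 hn0)
    simpa [this] using hn

theorem shiftBeta_restrict_bijective :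
    Function.Bijective (fun p : OmegaStar =>
      (⟨shiftBeta p.1, shiftBeta_mem_omegaStar p.2⟩ : OmegaStar)) := by
  constructor
  · intro p q h
    exact Subtype.ext (shiftBeta_injective (congrArg Subtype.val h))
  · rintro ⟨q, hq⟩
    obtain ⟨p, hp⟩ := exists_shiftBeta_eq hq
    refine ⟨⟨p, ?_⟩, Subtype.ext hp⟩
    rintro ⟨n, rfl⟩
    exact hq ⟨n + 1, by rw [← hp, shiftBeta_pure]⟩

/-- The shift map `σ` on `ω*`, the restriction of `shiftBeta`, as an autohomeomorphism of `ω*`;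
its inverse `σ⁻¹` is `shift.symm`. -/
noncomputable def shift : OmegaStar ≃ₜ OmegaStar :=
  Continuous.homeoOfEquivCompactToT2
    (f := Equiv.ofBijective
      (fun p : OmegaStar => (⟨shiftBeta p.1, shiftBeta_mem_omegaStar p.2⟩ : OmegaStar))
      shiftBeta_restrict_bijective)
    ((continuous_shiftBeta.comp continuous_subtype_val).subtype_mk _)

theorem shift_coe (p : OmegaStar) : (shift p : Ultrafilter ℕ) = shiftBeta p.1 := rfl

/-- For a compact Hausdorff space `X` and a continuous `f : X → X`, the dynamical system `(X, f)` is
a quotient of `(ω*, σ)` if there is a continuous surjection `Q : ω* → X` with `Q ∘ σ = f ∘ Q`. -/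
def IsQuotientOfShift {X : Type*} [TopologicalSpace X] [CompactSpace X] [T2Space X]
    (f : C(X, X)) : Prop :=
  ∃ Q : C(OmegaStar, X), Function.Surjective Q ∧ ⇑Q ∘ ⇑shift = ⇑f ∘ ⇑Q

/-- The Continuum Hypothesis: `2 ^ ℵ₀ = ℵ₁`. -/
def ContinuumHypothesis : Prop := (2 : Cardinal.{0}) ^ ℵ₀ = ℵ₁

/-! By Stone duality it is enough to find a Boolean embedding `h` of P(ω)/fin into itself that
conjugates B ↦ B − 1 to its inverse. Finitely many sets form a finite-valued sequence, and modulo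
finite errors only the graph of its infinitely recurring transitions matters. That graph is strongly
connected, so a closed walk covers it, and the walk run backwards realises the reversed graph
(`exists_isReversal`). Under CH, `h` is built by recursion of length ω₁. The induction hypothesis
`Extendible` asks that any further finite-valued sequence can be matched on the reversed side. A new
value of `h` must then meet countably many finite requirements at once. Any finitely many are met
jointly, by extendibility, and `exists_forall_transitions_eq` splices these partial solutions
(`Extendible.exists_insert`). -/

/-! ### Transition filters and splicing -/

open Filter in
/-- The filter of transitions of `c` that occur cofinally often. -/
def transitions {K : Type} (c : ℕ → K) : Filter (K × K) :=
  map (fun n => (c n, c (n + 1))) atTop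

open Filter in
/-- Simultaneous realisation of countably many recurrent-transition filters: if, for every `N`, the
first `N` levels are realised together by a sequence `x N`, then all of them are realised together.
The sequences are spliced at times where consecutive ones agree on the relevant levels. -/
theorem exists_forall_transitions_eq {S : Type} {K : ℕ → Type} [∀ M, Finite (K M)]
    (π : ∀ M, S → K M) (A : ∀ M, Filter (K M × K M)) (R : ℕ → S → Prop) (x : ℕ → ℕ → S)
    (hR : ∀ N n, R n (x N n))
    (hx : ∀ M N, M ≤ N → transitions (fun n => π M (x N n)) = A M) :
    ∃ y : ℕ → S, (∀ n, R n (y n)) ∧ ∀ M, transitions (fun n => π M (y n)) = A M := by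
  let U : Ultrafilter ℕ := hyperfilter ℕ
  have hU : (U : Filter ℕ) ≤ atTop := by
    rw [← Nat.cofinite_eq_atTop]; exact hyperfilter_le_cofinite
  have lim : ∀ {L : Type} [Finite L] (f : ℕ → L), ∃ l, ∀ᶠ k in (U : Filter ℕ), f k = l := by
    intro L _ f
    obtain ⟨l, _, hl⟩ := Ultrafilter.eq_pure_of_finite_mem (f := U.map f) Set.finite_univ univ_mem
    refine ⟨l, ?_⟩
    have : ({l} : Set L) ∈ U.map f := by rw [hl]; exact Ultrafilter.mem_pure.2 rfl
    exact this
  -- An iterated ultrafilter limit gives one state per level at which different `x N` can meet.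
  have ht : ∀ M, ∃ t : K M, ∀ᶠ N in (U : Filter ℕ), ∀ᶠ k in (U : Filter ℕ), π M (x N k) = t := by
    intro M
    choose f hf using fun N => lim (fun k => π M (x N k))
    obtain ⟨t, ht⟩ := lim f
    refine ⟨t, ht.mono fun N hN => ?_⟩
    filter_upwards [hf N] with k hk
    rw [hk, hN]
  choose t ht using ht
  have hw : ∀ M, ∃ w : ℕ → S, (∀ n, R n (w n)) ∧
      (∀ M' ≤ M, transitions (fun n => π M' (w n)) = A M') ∧
      ∀ᶠ k in (U : Filter ℕ), ∀ M' ≤ M, π M' (w k) = t M' := by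
    intro M
    have h1 : ∀ᶠ N in (U : Filter ℕ), ∀ M' ∈ Set.Iic M,
        ∀ᶠ k in (U : Filter ℕ), π M' (x N k) = t M' :=
      (eventually_all_finite (Set.finite_Iic M)).2 fun M' _ => ht M'
    obtain ⟨N, hN, hMN⟩ := (h1.and (hU (eventually_ge_atTop M))).exists
    exact ⟨x N, hR N, fun M' h => hx M' N (h.trans hMN),
      (eventually_all_finite (Set.finite_Iic M)).2 hN⟩
  choose w hwR hwA hwt using hw
  -- From time `τ` on, `w M` makes only recurrent transitions. Finiteness of `K M'` leaves finitely
  -- many `Φ` to handle.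
  have hτ : ∀ M, ∃ τ, ∀ n ≥ τ, ∀ M' ≤ M, ∀ Φ ∈ A M',
      (π M' (w M n), π M' (w M (n + 1))) ∈ Φ := by
    intro M
    refine eventually_atTop.1 ?_
    refine (eventually_all_finite (Set.finite_Iic M)).2 fun M' hM' => ?_
    refine (eventually_all_finite (Set.toFinite {Φ | Φ ∈ A M'})).2 fun Φ hΦ => ?_
    have : Φ ∈ transitions (fun n => π M' (w M n)) := by rw [hwA M M' hM']; exact hΦ
    exact this
  choose τ hτ using hτ
  -- The switch from `w M` to `w (M + 1)` waits until every recurrent transition has been seen since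
  -- `k`, and happens where both are in state `t M'` on all levels `M' ≤ M`.
  have hstep : ∀ M k, ∃ k', k < k' ∧ τ (M + 1) ≤ k' ∧
      (∀ M' ≤ M, ∀ Φ, Φ ∉ A M' → ∃ n, k ≤ n ∧ n < k' ∧
        (π M' (w M n), π M' (w M (n + 1))) ∉ Φ) ∧
      ∀ M' ≤ M, π M' (w (M + 1) k') = π M' (w M k') := by
    intro M k
    have hvis : ∀ᶠ k' in atTop, ∀ M' ∈ Set.Iic M, ∀ Φ ∈ {Φ | Φ ∉ A M'}, ∃ n, k ≤ n ∧ n < k' ∧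
        (π M' (w M n), π M' (w M (n + 1))) ∉ Φ := by
      refine (eventually_all_finite (Set.finite_Iic M)).2 fun M' hM' => ?_
      refine (eventually_all_finite (Set.toFinite _)).2 fun Φ hΦ => ?_
      have h : ∃ᶠ n in atTop, (π M' (w M n), π M' (w M (n + 1))) ∉ Φ := by
        intro h
        apply hΦ
        rw [← hwA M M' hM']
        exact (eventually_map.2 (h.mono fun n hn => not_not.1 hn) :)
      obtain ⟨n, hn, hnΦ⟩ := frequently_atTop.1 h k
      filter_upwards [eventually_gt_atTop n] with k' hk'
      exact ⟨n, hn, hk', hnΦ⟩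
    have hlarge := hvis.and ((eventually_gt_atTop k).and (eventually_ge_atTop (τ (M + 1))))
    obtain ⟨k', ⟨h1, h2, h3⟩, h4, h5⟩ :=
      ((hlarge.filter_mono hU).and ((hwt M).and (hwt (M + 1)))).exists
    exact ⟨k', h2, h3, h1, fun M' h => (h5 M' (h.trans M.le_succ)).trans (h4 M' h).symm⟩
  choose next hlt hge hvis hagree using hstep
  obtain ⟨κ, hκ0, hκs⟩ : ∃ κ : ℕ → ℕ, κ 0 = τ 0 ∧ ∀ M, κ (M + 1) = next M (κ M) :=
    ⟨fun M => Nat.rec (τ 0) (fun M k => next M k) M, rfl, fun _ => rfl⟩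
  have hκ : StrictMono κ := strictMono_nat_of_lt_succ fun M => (hκs M).symm ▸ hlt M (κ M)
  have hκτ : ∀ M, τ M ≤ κ M := by
    intro M
    cases M with
    | zero => exact hκ0.ge
    | succ M => exact (hκs M).symm ▸ hge M (κ M)
  let idx : ℕ → ℕ := fun n => Nat.findGreatest (fun M => κ M ≤ n) n
  have hidx : ∀ M n, κ M ≤ n → n < κ (M + 1) → idx n = M := by
    intro M n h1 h2
    refine le_antisymm ?_ (Nat.le_findGreatest (hκ.le_apply.trans h1) h1)
    by_contra hcon
    have : κ (idx n) ≤ n :=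
      Nat.findGreatest_spec (P := fun M => κ M ≤ n) (hκ.le_apply.trans h1) h1
    have h3 : κ (M + 1) ≤ κ (idx n) := hκ.monotone (show M + 1 ≤ idx n by omega)
    omega
  have hblock : ∀ n, κ 0 ≤ n → κ (idx n) ≤ n ∧ n < κ (idx n + 1) := by
    intro n hn
    refine ⟨Nat.findGreatest_spec (P := fun M => κ M ≤ n) (Nat.zero_le n) hn, ?_⟩
    by_contra hcon
    have h := not_lt.1 hcon
    have : idx n + 1 ≤ idx n := Nat.le_findGreatest (hκ.le_apply.trans h) h
    omega
  let y : ℕ → S := fun n => w (idx n) n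
  -- The last transition of a block ends in the next block; agreement at the switch makes it a
  -- transition of `w M`.
  have hy : ∀ M n, κ M ≤ n → n < κ (M + 1) → ∀ M' ≤ M,
      (π M' (y n), π M' (y (n + 1))) = (π M' (w M n), π M' (w M (n + 1))) := by
    intro M n h1 h2 M' hM'
    have e1 : y n = w M n := by simp only [y, hidx M n h1 h2]
    have e2 : π M' (y (n + 1)) = π M' (w M (n + 1)) := by
      rcases Nat.lt_or_ge (n + 1) (κ (M + 1)) with h | h
      · simp only [y, hidx M (n + 1) (by omega) h]
      · have h' : n + 1 = κ (M + 1) := by omega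
        have : idx (n + 1) = M + 1 := hidx (M + 1) (n + 1) h'.ge
          (h'.trans_lt (hκ (Nat.lt_succ_self _)))
        simp only [y, this]
        rw [h']
        rw [hκs]
        exact hagree M (κ M) M' hM'
    rw [e1, e2]
  refine ⟨y, fun n => hwR _ n, fun M => ?_⟩
  ext Φ
  constructor
  · intro h
    by_contra hΦ
    obtain ⟨n0, hn0⟩ := eventually_atTop.1 (show ∀ᶠ n in atTop, (π M (y n), π M (y (n + 1))) ∈ Φ
      from h)
    have hM : M ≤ max M n0 := le_max_left _ _
    obtain ⟨n, h1, h2, h3⟩ := hvis (max M n0) (κ (max M n0)) M hM Φ hΦ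
    rw [← hκs] at h2
    rw [← hy _ n h1 h2 M hM] at h3
    exact h3 (hn0 n ((le_max_right M n0).trans (hκ.le_apply.trans h1)))
  · intro hΦ
    refine eventually_map.2 (eventually_atTop.2 ⟨κ M, fun n hn => ?_⟩)
    obtain ⟨h1, h2⟩ := hblock n ((hκ.monotone (Nat.zero_le M)).trans hn)
    have hM : M ≤ idx n := Nat.le_findGreatest (hκ.le_apply.trans hn) hn
    rw [hy _ n h1 h2 M hM]
    exact hτ _ n ((hκτ _).trans h1) M hM Φ hΦ

/-! ### Time reversal of finite-valued sequences -/

/-- `d` has the recurrent transitions of `c`, reversed in time. -/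
def IsReversal {K : Type} (c d : ℕ → K) : Prop :=
  transitions d = Filter.map Prod.swap (transitions c)

theorem transitions_comp {K L : Type} (g : K → L) (c : ℕ → K) :
    transitions (fun n => g (c n)) = Filter.map (Prod.map g g) (transitions c) := by
  simp only [transitions, Filter.map_map]; rfl

theorem IsReversal.comp {K L : Type} {c d : ℕ → K} (h : IsReversal c d) (g : K → L) :
    IsReversal (fun n => g (c n)) (fun n => g (d n)) := by
  unfold IsReversal at h ⊢
  rw [transitions_comp g d, transitions_comp g c, h, Filter.map_map, Filter.map_map]
  rfl

open Filter in
theorem IsReversal.eventually_iff {K : Type} {c d : ℕ → K} (h : IsReversal c d)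
    (Φ : K → K → Prop) :
    (∀ᶠ n in atTop, Φ (d n) (d (n + 1))) ↔ ∀ᶠ n in atTop, Φ (c (n + 1)) (c n) := by
  have h' : {e : K × K | Φ e.1 e.2} ∈ transitions d ↔
      {e : K × K | Φ e.1 e.2} ∈ map Prod.swap (transitions c) := by rw [h]
  exact h'

open Filter in
theorem IsReversal.eventually_iff' {K : Type} {c d : ℕ → K} (h : IsReversal c d) (Φ : K → Prop) :
    (∀ᶠ n in atTop, Φ (d n)) ↔ ∀ᶠ n in atTop, Φ (c n) := by
  rw [h.eventually_iff (fun u _ => Φ u)]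
  have : map (fun n : ℕ => n + 1) atTop = atTop := map_add_atTop_eq_nat 1
  conv_rhs => rw [← this]
  rfl

open Filter in
/-- Over a finite alphabet, every sequence has a reversal. -/
theorem exists_isReversal {K : Type} [Finite K] (c : ℕ → K) : ∃ d, IsReversal c d := by
  obtain ⟨s, hs⟩ := eventually_atTop.1
    ((eventually_all_finite (Set.toFinite {Φ | Φ ∈ transitions c})).2 fun Φ hΦ =>
      show ∀ᶠ n in atTop, (c n, c (n + 1)) ∈ Φ from hΦ)
  obtain ⟨v, hv⟩ : ∃ v, ∃ᶠ n in atTop, c n = v := by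
    by_contra hcon
    push Not at hcon
    obtain ⟨n, hn⟩ := (eventually_all.2 hcon).exists
    exact hn _ rfl
  obtain ⟨a, hsa, hav⟩ := frequently_atTop.1 hv s
  have hvis : ∀ᶠ t in atTop, ∀ Φ ∈ {Φ | Φ ∉ transitions c},
      ∃ n, a ≤ n ∧ n < t ∧ (c n, c (n + 1)) ∉ Φ := by
    refine (eventually_all_finite (Set.toFinite _)).2 fun Φ hΦ => ?_
    have h : ∃ᶠ n in atTop, (c n, c (n + 1)) ∉ Φ := fun h =>
      hΦ (eventually_map.2 (h.mono fun n hn => not_not.1 hn) :)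
    obtain ⟨n, hn, hnΦ⟩ := frequently_atTop.1 h a
    filter_upwards [eventually_gt_atTop n] with k' hk'
    exact ⟨n, hn, hk', hnΦ⟩
  -- Between `a` and `b` the sequence runs through a closed walk at `v` that uses exactly the
  -- recurrent transitions.
  obtain ⟨b, hbv, hab, hvis⟩ := (hv.and_eventually ((eventually_gt_atTop a).and hvis)).exists
  obtain ⟨L, rfl⟩ : ∃ L, b = a + L := ⟨b - a, by omega⟩
  have hL : 0 < L := by omega
  have key : ∀ n, (c (a + L - n % L), c (a + L - (n + 1) % L)) =
      Prod.swap (c (a + L - n % L - 1), c (a + L - n % L - 1 + 1)) := by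
    intro n
    have hlt := Nat.mod_lt n hL
    have e : a + L - n % L - 1 + 1 = a + L - n % L := by omega
    rw [e, Prod.swap_prod_mk]
    rcases Nat.lt_or_ge (n % L + 1) L with h | h
    · rw [Nat.add_mod_of_add_mod_lt (by rw [Nat.mod_eq_of_lt (a := 1) (by omega)]; exact h),
        Nat.mod_eq_of_lt (a := 1) (by omega)]
      congr 2
    · have h0 : (n + 1) % L = 0 := by
        have : n % L + 1 = L := by omega
        rw [Nat.add_mod, ← Nat.add_mod, ← Nat.mod_add_mod, this, Nat.mod_self]
      rw [h0, show a + L - n % L - 1 = a by omega, Nat.sub_zero, hbv, hav]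
  refine ⟨fun n => c (a + L - n % L), ?_⟩
  unfold IsReversal
  ext Φ
  constructor
  · intro h
    by_contra hΦ
    obtain ⟨n0, hn0⟩ := eventually_atTop.1
      (show ∀ᶠ n in atTop, (c (a + L - n % L), c (a + L - (n + 1) % L)) ∈ Φ from h)
    obtain ⟨n, h1, h2, h3⟩ := hvis (Prod.swap ⁻¹' Φ) hΦ
    obtain ⟨i, rfl⟩ : ∃ i, n = a + i := ⟨n - a, by omega⟩
    -- A time past `n0` at which the backward walk reverses the transition at `a + i`.
    have h4 := hn0 (L - 1 - i + L * n0)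
      ((Nat.le_mul_of_pos_left n0 hL).trans (Nat.le_add_left _ _))
    rw [key, Nat.add_mul_mod_self_left, Nat.mod_eq_of_lt (by omega),
      show a + L - (L - 1 - i) - 1 = a + i by omega] at h4
    exact h3 h4
  · intro hΦ
    refine eventually_map.2 (Eventually.of_forall fun n => ?_)
    rw [key]
    have hlt := Nat.mod_lt n hL
    exact hs (a + L - n % L - 1) (by omega) _ hΦ

/-! ### Extendible partial maps -/

/-- `G` is extendible if for every finite part of `G` the second components, together with a
suitable finite-valued sequence, reverse the first components together with a given one. -/
def Extendible (G : Set (Set ℕ × Set ℕ)) : Prop :=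
  ∀ F : Finset (Set ℕ × Set ℕ), ↑F ⊆ G → ∀ (m : ℕ) (z : ℕ → Fin m), ∃ y : ℕ → Fin m,
    IsReversal (fun n => (fun i : F => n ∈ i.1.1, z n)) (fun n => (fun i : F => n ∈ i.1.2, y n))

theorem extendible_empty : Extendible ∅ := by
  intro F hF m z
  obtain ⟨y, hy⟩ := exists_isReversal z
  have hemp : ∀ i : F, False := fun i => hF i.2
  refine ⟨y, ?_⟩
  convert hy.comp (fun u => ((fun i => (hemp i).elim : F → Prop), u)) using 3 <;>
    exact funext fun i => (hemp i).elim

theorem Extendible.of_finite {G : Set (Set ℕ × Set ℕ)}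
    (h : ∀ F : Finset (Set ℕ × Set ℕ), ↑F ⊆ G → ∃ G', ↑F ⊆ G' ∧ Extendible G') :
    Extendible G := fun F hF =>
  let ⟨_, hF', hG'⟩ := h F hF
  hG' F hF'

theorem Extendible.exists_isReversal {G : Set (Set ℕ × Set ℕ)} (hG : Extendible G)
    (F : Finset (Set ℕ × Set ℕ)) (hF : ↑F ⊆ G) {K : Type} [Finite K] (z : ℕ → K) :
    ∃ y : ℕ → K, IsReversal (fun n => (fun i : F => n ∈ i.1.1, z n))
      (fun n => (fun i : F => n ∈ i.1.2, y n)) := by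
  obtain ⟨m, ⟨e⟩⟩ := Finite.exists_equiv_fin K
  obtain ⟨y, hy⟩ := hG F hF m (fun n => e (z n))
  refine ⟨fun n => e.symm (y n), ?_⟩
  simpa using hy.comp (Prod.map id e.symm)

theorem Filter.countable_of_finite (T : Type) [Finite T] : Countable (Filter T) :=
  Function.Injective.countable (f := Filter.sets) fun _ _ h => Filter.filter_eq h

/-- Extendibility over a countable set passes to one more element. -/
theorem Extendible.exists_insert {G : Set (Set ℕ × Set ℕ)} (hG : Extendible G)
    (hc : G.Countable) (b : Set ℕ) : ∃ a, Extendible (insert (b, a) G) := by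
  classical
  let P := {F : Finset (Set ℕ × Set ℕ) // ↑F ⊆ G}
  let T : P → ℕ → Type := fun F m => (F.1 → Prop) × Prop × Fin m
  let c : ∀ (F : P) (m : ℕ), (ℕ → Fin m) → ℕ → T F m :=
    fun F m z n => (fun i => n ∈ i.1.1, n ∈ b, z n)
  -- Requirements are indexed by the transition filter and not by `z`, which makes them countable in
  -- number.
  let Γ := {γ : Σ (F : P) (m : ℕ), Filter (T F m × T F m) //
    ∃ z, transitions (c γ.1 γ.2.1 z) = γ.2.2}
  have hP : Countable P := by
    have := hc.to_subtype
    refine Function.Injective.countable (f := fun F : P => F.1.subtype (· ∈ G)) ?_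
    intro F F' h
    apply Subtype.ext
    ext p
    have h' := fun hp : p ∈ G => congrArg (fun s => (⟨p, hp⟩ : {x // x ∈ G}) ∈ s) h
    simp only [Finset.mem_subtype, eq_iff_iff] at h'
    exact ⟨fun hp => (h' (F.2 hp)).1 hp, fun hp => (h' (F'.2 hp)).2 hp⟩
  have hΓ : Countable Γ := by
    have := fun F m => Filter.countable_of_finite (T F m × T F m)
    infer_instance
  have hne : Nonempty Γ :=
    ⟨⟨⟨⟨∅, by simp⟩, 1, transitions (c _ 1 fun _ => 0)⟩, fun _ => 0, rfl⟩⟩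
  obtain ⟨e, he⟩ := exists_surjective_nat Γ
  choose z hz using fun γ : Γ => γ.2
  let S := ((Set ℕ × Set ℕ) → Prop) × Prop × (∀ γ : Γ, Fin γ.1.2.1)
  -- A state holds the prescribed memberships, the bit of the new set `a`, and one companion value
  -- per requirement. The bit is shared by all levels, so a single `a` serves them all.
  let π : ∀ M, S → T (e M).1.1 (e M).1.2.1 := fun M s => (fun i => s.1 i.1, s.2.1, s.2.2 (e M))
  have hx : ∀ N, ∃ x : ℕ → S, (∀ n, (x n).1 = fun i => n ∈ i.2) ∧
      ∀ M ≤ N, transitions (fun n => π M (x n)) = Filter.map Prod.swap (e M).1.2.2 := by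
    intro N
    let F : Finset (Set ℕ × Set ℕ) := (Finset.range (N + 1)).biUnion fun M => (e M).1.1.1
    have hF : ↑F ⊆ G := by
      intro p hp
      obtain ⟨M, _, hM⟩ := Finset.mem_biUnion.1 (Finset.mem_coe.1 hp)
      exact (e M).1.1.2 hM
    let s : Finset Γ := (Finset.range (N + 1)).image e
    obtain ⟨y, hy⟩ := hG.exists_isReversal F hF
      (K := Prop × (∀ γ : s, Fin γ.1.1.2.1)) (fun n => (n ∈ b, fun γ => z γ n))
    -- Companions of requirements outside `s` are never inspected at this stage; `z γ 0` is a
    -- filler.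
    refine ⟨fun n => (fun i => n ∈ i.2, (y n).1,
      fun γ => if h : γ ∈ s then (y n).2 ⟨γ, h⟩ else z γ 0), fun n => rfl, fun M hM => ?_⟩
    have hMN : M ∈ Finset.range (N + 1) := Finset.mem_range.2 (Nat.lt_succ_of_le hM)
    have hs : e M ∈ s := Finset.mem_image_of_mem e hMN
    have hMF : ∀ i ∈ (e M).1.1.1, i ∈ F := fun i hi => Finset.mem_biUnion.2 ⟨M, hMN, hi⟩
    have h := hy.comp (fun u => ((fun i => u.1 ⟨i.1, hMF i.1 i.2⟩, u.2.1, u.2.2 ⟨e M, hs⟩) :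
      T (e M).1.1 (e M).1.2.1))
    rw [← hz (e M)]
    simp only [π, dif_pos hs]
    exact h
  choose x hxR hxA using hx
  obtain ⟨y, hyR, hyA⟩ := exists_forall_transitions_eq π
    (fun M => Filter.map Prod.swap (e M).1.2.2) (fun n s => s.1 = fun i => n ∈ i.2) x hxR
    (fun M N h => hxA N M h)
  refine ⟨{n | (y n).2.1}, fun F hF m w => ?_⟩
  set p : Set ℕ × Set ℕ := (b, {n | (y n).2.1}) with hp
  have hF' : ↑(F.erase p) ⊆ G := by
    intro i hi
    have hi' := Finset.mem_erase.1 (Finset.mem_coe.1 hi)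
    exact (hF hi'.2).resolve_left hi'.1
  let P₀ : P := ⟨F.erase p, hF'⟩
  let γ : Γ := ⟨⟨P₀, m, transitions (c P₀ m w)⟩, w, rfl⟩
  -- The representative `z γ` may differ from `w`, but has the same transition filter.
  obtain ⟨M, hM⟩ := he γ
  have key : IsReversal (c P₀ m w)
      (fun n => ((fun i => n ∈ i.1.2, n ∈ p.2, (y n).2.2 γ) : T P₀ m)) := by
    have h := hyA M
    simp only [π, hyR] at h
    rw [hM] at h
    exact h
  refine ⟨fun n => (y n).2.2 γ, ?_⟩
  convert key.comp (fun u => ((fun i => if h : i.1 = p then u.2.1 else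
    u.1 ⟨i.1, Finset.mem_erase.2 ⟨h, i.2⟩⟩, u.2.2) : (F → Prop) × Fin m)) using 1
  · refine funext fun n => Prod.ext (funext fun i => ?_) rfl
    by_cases h : i.1 = p
    · simp only [h, dif_pos, c, hp]
    · simp only [h, dif_neg, not_false_iff, c]
  · refine funext fun n => Prod.ext (funext fun i => ?_) rfl
    by_cases h : i.1 = p
    · simp only [h, dif_pos, hp]
    · simp only [h, dif_neg, not_false_iff]

/-! ### Transfinite recursion under CH -/

/-- In a well-order of minimal type, proper initial segments have size below 2^ℵ₀ = ℵ₁. -/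
theorem ContinuumHypothesis.exists_wellOrder (hCH : ContinuumHypothesis) :
    ∃ r : Set ℕ → Set ℕ → Prop, IsWellOrder (Set ℕ) r ∧ ∀ a, {b | r b a}.Countable := by
  obtain ⟨r, hr, h⟩ := Cardinal.exists_ord_eq (Set ℕ)
  refine ⟨r, hr, fun a => ?_⟩
  have h1 := Cardinal.card_typein_lt a h
  rw [Cardinal.mk_set, Cardinal.mk_nat, show (2 : Cardinal.{0}) ^ ℵ₀ = ℵ₁ from hCH] at h1
  exact Cardinal.le_aleph0_iff_set_countable.1 (Cardinal.lt_aleph_one_iff.1 h1)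

/-- Under the Continuum Hypothesis some function on `Set ℕ` has an extendible graph. -/
theorem ContinuumHypothesis.exists_extendible_graph (hCH : ContinuumHypothesis) :
    ∃ h : Set ℕ → Set ℕ, Extendible {p | p.2 = h p.1} := by
  obtain ⟨r, hr, hc⟩ := hCH.exists_wellOrder
  have hwf : WellFounded r := hr.wf
  -- `epsilon` lets the recursion be defined before a suitable value is known to exist; `hext`
  -- supplies existence by induction.
  let h : Set ℕ → Set ℕ := hwf.fix fun b ih =>
    Classical.epsilon fun a => Extendible (insert (b, a) {p | ∃ hp : r p.1 b, p.2 = ih p.1 hp})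
  have hh : ∀ b, h b = Classical.epsilon fun a =>
      Extendible (insert (b, a) {p | r p.1 b ∧ p.2 = h p.1}) := by
    intro b
    simp only [h]
    rw [hwf.fix_eq]
    simp only [exists_prop]
  have hmax : ∀ F : Finset (Set ℕ × Set ℕ), F.Nonempty → ∃ q ∈ F, ∀ p ∈ F, r p.1 q.1 ∨ p.1 = q.1 := by
    intro F hF
    induction hF using Finset.Nonempty.cons_induction with
    | singleton a => exact ⟨a, by simp, by simp⟩
    | cons a s ha hs ih =>
      obtain ⟨q, hq, hqs⟩ := ih
      rcases trichotomous_of r a.1 q.1 with h | h | h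
      · exact ⟨q, by simp [hq], by simpa [h] using fun a b => hqs (a, b)⟩
      · exact ⟨q, by simp [hq], by simpa [h] using fun a b => hqs (a, b)⟩
      · refine ⟨a, by simp, fun p hp => ?_⟩
        rcases Finset.mem_cons.1 hp with rfl | hp
        · exact Or.inr rfl
        · rcases hqs p hp with h' | h'
          · exact Or.inl (_root_.trans h' h)
          · exact Or.inl (h' ▸ h)
  have hext : ∀ b, Extendible (insert (b, h b) {p | r p.1 b ∧ p.2 = h p.1}) := by
    intro b
    induction b using hwf.induction with
    | _ b ih =>
    have hG : Extendible {p | r p.1 b ∧ p.2 = h p.1} := by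
      -- Extendibility is of finite character, and a finite `F` lies in the stage of its largest
      -- first component.
      refine Extendible.of_finite fun F hF => ?_
      rcases F.eq_empty_or_nonempty with rfl | hne
      · exact ⟨∅, by simp, extendible_empty⟩
      · obtain ⟨q, hq, hqF⟩ := hmax F hne
        refine ⟨_, fun p hp => ?_, ih q.1 (hF hq).1⟩
        rcases hqF p hp with h' | h'
        · exact Or.inr ⟨h', (hF hp).2⟩
        · exact Or.inl (Prod.ext h' (by rw [← h']; exact (hF hp).2))
    have hcount : {p : Set ℕ × Set ℕ | r p.1 b ∧ p.2 = h p.1}.Countable := by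
      refine ((hc b).image fun a => (a, h a)).mono ?_
      rintro p ⟨hp, hp'⟩
      exact ⟨p.1, hp, Prod.ext rfl hp'.symm⟩
    rw [hh b]
    exact Classical.epsilon_spec (hG.exists_insert hcount b)
  refine ⟨h, Extendible.of_finite fun F hF => ?_⟩
  rcases F.eq_empty_or_nonempty with rfl | hne
  · exact ⟨∅, by simp, extendible_empty⟩
  · obtain ⟨q, hq, hqF⟩ := hmax F hne
    refine ⟨_, fun p hp => ?_, hext q.1⟩
    rcases hqF p hp with h' | h'
    · exact Or.inr ⟨h', hF hp⟩
    · exact Or.inl (Prod.ext h' (by rw [← h']; exact hF hp))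

/-! ### The dual map on ultrafilters -/

/-- Every finite family of sets is reversed by its image under a map with extendible graph. -/
theorem Extendible.isReversal {h : Set ℕ → Set ℕ} (hh : Extendible {p | p.2 = h p.1})
    {ι : Type} [Finite ι] (f : ι → Set ℕ) :
    IsReversal (fun n i => n ∈ f i) (fun n i => n ∈ h (f i)) := by
  classical
  have := Fintype.ofFinite ι
  obtain ⟨y, hy⟩ := hh (Finset.univ.image fun i => (f i, h (f i)))
    (by intro p; simp; rintro i rfl; rfl) 1 (fun _ => 0)
  exact hy.comp fun u i => u.1 ⟨(f i, h (f i)), Finset.mem_image_of_mem _ (Finset.mem_univ i)⟩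

namespace Extendible
open Filter

variable {h : Set ℕ → Set ℕ}

/-- Boolean relations modulo finite sets transfer both ways, so `h` is a homomorphism and is
injective modulo finite. Three sets suffice for intersections. -/
theorem eventually_iff (hh : Extendible {p | p.2 = h p.1}) (A B C : Set ℕ)
    (Φ : Prop → Prop → Prop → Prop) :
    (∀ᶠ n in atTop, Φ (n ∈ h A) (n ∈ h B) (n ∈ h C)) ↔
      ∀ᶠ n in atTop, Φ (n ∈ A) (n ∈ B) (n ∈ C) :=
  (hh.isReversal ![A, B, C]).eventually_iff' fun u => Φ (u 0) (u 1) (u 2)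

/-- The trivial relation n ∈ B − 1 ↔ n + 1 ∈ B is a property of transitions, and reversal exchanges
their two ends. -/
theorem eventually_shift (hh : Extendible {p | p.2 = h p.1}) (B : Set ℕ) :
    ∀ᶠ n in atTop, n + 1 ∈ h {k | k + 1 ∈ B} ↔ n ∈ h B :=
  ((hh.isReversal ![{k | k + 1 ∈ B}, B]).eventually_iff fun u v => (v 0 ↔ u 1)).2
    (Eventually.of_forall fun _ => Iff.rfl)

/-- The ultrafilter `{B | h B ∈ p}`. -/
def ultrafilter (hh : Extendible {p | p.2 = h p.1}) (p : Ultrafilter ℕ)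
    (hp : (p : Filter ℕ) ≤ atTop) : Ultrafilter ℕ :=
  Ultrafilter.ofComplNotMemIff
    { sets := {B | h B ∈ p}
      univ_sets := by
        have H := (hh.eventually_iff Set.univ Set.univ Set.univ fun a _ _ => a).2 (by simp)
        exact hp H
      sets_of_superset := by
        intro A B hA hAB
        have H := (hh.eventually_iff A B B fun a b _ => (a → b)).2
          (Eventually.of_forall fun n hn => hAB hn)
        have hA' : ∀ᶠ n in (p : Filter ℕ), n ∈ h A := hA
        exact (hA'.and (H.filter_mono hp)).mono fun n hn => hn.2 hn.1
      inter_sets := by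
        intro A B hA hB
        have H := (hh.eventually_iff A B (A ∩ B) fun a b c => (a → b → c)).2
          (Eventually.of_forall fun n h1 h2 => ⟨h1, h2⟩)
        have hA' : ∀ᶠ n in (p : Filter ℕ), n ∈ h A := hA
        have hB' : ∀ᶠ n in (p : Filter ℕ), n ∈ h B := hB
        exact ((hA'.and hB').and (H.filter_mono hp)).mono fun n hn => hn.2 hn.1.1 hn.1.2 }
    (by
      intro A
      have H := (hh.eventually_iff A Aᶜ A fun a b _ => (b ↔ ¬ a)).2
        (Eventually.of_forall fun n => Iff.rfl)
      change h Aᶜ ∉ p ↔ h A ∈ p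
      have H' : h Aᶜ ∈ p ↔ (h A)ᶜ ∈ p := Filter.congr_sets (H.filter_mono hp)
      rw [H', Ultrafilter.compl_notMem_iff])

theorem mem_ultrafilter (hh : Extendible {p | p.2 = h p.1}) {p : Ultrafilter ℕ}
    {hp : (p : Filter ℕ) ≤ atTop} {B : Set ℕ} : B ∈ hh.ultrafilter p hp ↔ h B ∈ p := Iff.rfl

/-- The filter generated by the cofinite sets and the sets `h B` for `B ∈ q`. -/
def preimageFilter (hh : Extendible {p | p.2 = h p.1}) (q : Ultrafilter ℕ) : Filter ℕ where
  sets := {S | ∃ B ∈ q, ∀ᶠ n in atTop, n ∈ h B → n ∈ S}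
  univ_sets := ⟨Set.univ, univ_mem, by simp⟩
  sets_of_superset := fun ⟨B, hB, H⟩ hST => ⟨B, hB, H.mono fun _ hn hb => hST (hn hb)⟩
  inter_sets := fun ⟨B, hB, H⟩ ⟨C, hC, H'⟩ => ⟨B ∩ C, inter_mem hB hC, by
    have K := (hh.eventually_iff (B ∩ C) B C fun a b c => (a → b ∧ c)).2
      (Eventually.of_forall fun n hn => hn)
    filter_upwards [H, H', K] with n h1 h2 h3 h4 using ⟨h1 (h3 h4).1, h2 (h3 h4).2⟩⟩

/-- This is injectivity of `h` modulo finite: if `h B` is finite, so is `B`, which then cannot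
belong to `q`. -/
theorem preimageFilter_neBot (hh : Extendible {p | p.2 = h p.1}) {q : Ultrafilter ℕ}
    (hq : (q : Filter ℕ) ≤ atTop) : (hh.preimageFilter q).NeBot := by
  refine ⟨fun hbot => ?_⟩
  obtain ⟨B, hB, H⟩ : ∅ ∈ hh.preimageFilter q := by rw [hbot]; exact mem_bot
  have K := (hh.eventually_iff B B B fun a _ _ => ¬ a).1 (H.mono fun n hn hb => hn hb)
  have hB' : ∀ᶠ n in (q : Filter ℕ), n ∈ B := hB
  obtain ⟨n, h1, h2⟩ := (hB'.and (K.filter_mono hq)).exists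
  exact h2 h1

end Extendible

/-! ### The quotient map -/

theorem mem_omegaStar_iff {p : Ultrafilter ℕ} :
    p ∉ Set.range (pure : ℕ → Ultrafilter ℕ) ↔ (p : Filter ℕ) ≤ Filter.atTop := by
  rw [← Nat.cofinite_eq_atTop]
  constructor
  · intro hp
    exact p.le_cofinite_or_eq_pure.resolve_right fun ⟨a, ha⟩ => hp ⟨a, ha.symm⟩
  · rintro hp ⟨n, rfl⟩
    have : ({n}ᶜ : Set ℕ) ∈ (pure n : Ultrafilter ℕ) := hp (Set.finite_singleton n).compl_mem_cofinite
    simp at this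

theorem mainTheorem6 (hCH : ContinuumHypothesis) :
    IsQuotientOfShift (shift.symm : C(OmegaStar, OmegaStar)) := by
  obtain ⟨h, hh⟩ := hCH.exists_extendible_graph
  have hle : ∀ p : OmegaStar, (p.1 : Filter ℕ) ≤ Filter.atTop := fun p => mem_omegaStar_iff.1 p.2
  have hQ : ∀ p : OmegaStar, hh.ultrafilter p.1 (hle p) ∉ Set.range (pure : ℕ → Ultrafilter ℕ) := by
    intro p
    rw [mem_omegaStar_iff]
    intro S hS
    exact hle p ((hh.eventually_iff S S S fun a _ _ => a).2 hS)
  refine ⟨⟨fun p => ⟨hh.ultrafilter p.1 (hle p), hQ p⟩, ?_⟩, ?_, ?_⟩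
  · refine Continuous.subtype_mk (ultrafilterBasis_is_basis.continuous_iff.2 ?_) _
    rintro _ ⟨s, rfl⟩
    exact (ultrafilter_isOpen_basic (h s)).preimage continuous_subtype_val
  · intro q
    have := hh.preimageFilter_neBot (hle q)
    -- Any ultrafilter refining `preimageFilter` is a preimage of `q`, since it contains `h B` for
    -- all `B ∈ q`.
    have hp := Ultrafilter.of_le (hh.preimageFilter q.1)
    refine ⟨⟨Ultrafilter.of (hh.preimageFilter q.1), mem_omegaStar_iff.2 (hp.trans ?_)⟩, ?_⟩
    · exact fun S hS => ⟨Set.univ, Filter.univ_mem, Filter.Eventually.mono hS fun n hn _ => hn⟩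
    · refine Subtype.ext (Ultrafilter.eq_of_le fun B hB => hp ?_)
      exact ⟨B, hB, Filter.Eventually.of_forall fun n hn => hn⟩
  · funext p
    change _ = shift.symm _
    -- The equation becomes σ(Q(σ p)) = Q p, which tested on `B` is `eventually_shift`.
    rw [Homeomorph.eq_symm_apply]
    apply Subtype.ext
    rw [shift_coe]
    refine Ultrafilter.ext fun B => ?_
    exact Filter.congr_sets ((hh.eventually_shift B).filter_mono (hle p))
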